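/- **Proposition 5.10.** Let $(a_n)_{n\ge 0}$ and $(b_n)_{n\ge 0}$ be sequences of real numbers, put $a_{-1}=0$, and let $J_0$ be the operator in the complex Hilbert space $\ell^2(\mathbb Z_+)$ with domain $\mathcal D$, the set of vectors $u=(u_0,u_1,\dots)$ with only finitely many non-zero components, given by $$(J_0u)_n=a_{n-1}u_{n-1}+b_nu_n+a_nu_{n+1},\qquad n\ge 0,\quad u_{-1}=0 .$$ Consider on $\mathcal D$ the quadratic form $$J[u,u]=(J_0u,u)=\sum_{n=0}^\infty b_n|u_n|^2+\sum_{n=0}^\infty\big(a_{n-1}u_{n-1}+a_nu_{n+1}\big)\bar u_n .$$ Suppose that $b_n\to+\infty$ (or $b_n\to-\infty$) and that $$s_n:=|b_n|-|a_{n-1}|-|a_n|\to\infty\qquad\text{as } n\to\infty .$$ Then the form $J[u,u]$ is bounded from below (from above, if $b_n\to-\infty$), that is, there is a real $m$ with $J[u,u]\ge m\|u\|^2$ (respectively $J[u,u]\le m\|u\|^2$) for all $u\in\mathcal D$, and it is closable. There is a unique operator $J$ associated with the closure of this form: $u$ belongs to the domain of $J$ and $Ju=w$ if and only if $u$ belongs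 to the domain of the closure and $J[u,v]=(w,v)$ for all $v$ in the domain of the closure. The operator $J$ is self-adjoint, and its spectrum is discrete, that is, it consists of isolated eigenvalues of finite multiplicity. -/

import Mathlib

open Filter Topology
open scoped ComplexConjugate ENNReal

noncomputable section

/-! ## Symmetric sesquilinear forms in a Hilbert space -/

/-- A symmetric (Hermitian) sesquilinear form `q` in `H`, defined on a linear subspace
`q.domain` of `H`. As for Mathlib's `inner`, it is conjugate linear in the first argument and
linear in the second; in the notation `q[u,v]` of the texts where a form is linear in the first
argument, `q[u,v]` is `q.form v u`. -/
structure HermForm (H : Type*) [NormedAddCommGroup H] [InnerProductSpace ℂ H] where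
  domain : Submodule ℂ H
  form : domain →ₗ⋆[ℂ] domain →ₗ[ℂ] ℂ
  symm : ∀ u v : domain, conj (form u v) = form v u

namespace HermForm

variable {H : Type*} [NormedAddCommGroup H] [InnerProductSpace ℂ H]

/-- There is a real `m` with `q[u,u] ≥ m ‖u‖²` for all `u` in the domain.
(The number `q[u,u]` is real by symmetry.) -/
def IsBoundedBelow (q : HermForm H) : Prop :=
  ∃ m : ℝ, ∀ u : q.domain, m * ‖(u : H)‖ ^ 2 ≤ (q.form u u).re

/-- There is a real `M` with `q[u,u] ≤ M ‖u‖²` for all `u` in the domain. -/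
def IsBoundedAbove (q : HermForm H) : Prop :=
  ∃ M : ℝ, ∀ u : q.domain, (q.form u u).re ≤ M * ‖(u : H)‖ ^ 2

/-- `q[x n - x m, x n - x m] → 0` as `n, m → ∞`. -/
def IsFormCauchy (q : HermForm H) (x : ℕ → q.domain) : Prop :=
  Tendsto (fun p : ℕ × ℕ => q.form (x p.1 - x p.2) (x p.1 - x p.2)) atTop (𝓝 0)

/-- Closability of a (semibounded) form: if `x n → 0` in `H` and `q[x n - x m] → 0`, then
`q[x n] → 0`. -/
def IsClosable (q : HermForm H) : Prop :=
  ∀ x : ℕ → q.domain, Tendsto (fun n => (x n : H)) atTop (𝓝 0) → q.IsFormCauchy x →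
    Tendsto (fun n => q.form (x n) (x n)) atTop (𝓝 0)

/-- A closed form: it is semibounded and, whenever `x n → u` in `H` and `q[x n - x m] → 0`, the
vector `u` belongs to the domain and `q[x n - u] → 0`. -/
def IsClosed (q : HermForm H) : Prop :=
  (q.IsBoundedBelow ∨ q.IsBoundedAbove) ∧
  ∀ (x : ℕ → q.domain) (u : H), Tendsto (fun n => (x n : H)) atTop (𝓝 u) → q.IsFormCauchy x →
    ∃ hu : u ∈ q.domain, Tendsto (fun n => q.form (x n - ⟨u, hu⟩) (x n - ⟨u, hu⟩)) atTop (𝓝 0)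

/-- `q'` is an extension of `q`. -/
def Extends (q' q : HermForm H) : Prop :=
  ∃ h : q.domain ≤ q'.domain, ∀ u v : q.domain,
    q'.form (Submodule.inclusion h u) (Submodule.inclusion h v) = q.form u v

/-- `q'` is the closure of `q`: a closed extension of `q` in which the domain of `q` is dense with
respect to the form norm. -/
def IsClosureOf (q' q : HermForm H) : Prop :=
  q'.IsClosed ∧ q'.Extends q ∧
  ∀ u : q'.domain, ∃ x : ℕ → q'.domain, (∀ n, (x n : H) ∈ q.domain) ∧
    Tendsto (fun n => (x n : H)) atTop (𝓝 u) ∧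
    Tendsto (fun n => q'.form (x n - u) (x n - u)) atTop (𝓝 0)

/-- `A` is the operator associated with the form `q`: a vector `u` belongs to the domain of `A` and
`A u = w` iff `u` belongs to the domain of `q` and `q[u,v] = (w,v)` for all `v` in the domain
of `q`. -/
def IsAssociated (q : HermForm H) (A : H →ₗ.[ℂ] H) : Prop :=
  ∀ u w : H, (u, w) ∈ A.graph ↔
    ∃ hu : u ∈ q.domain, ∀ v : q.domain, q.form v ⟨u, hu⟩ = inner ℂ (v : H) w

/-- `A` is the operator defined by the (closable) form `q`, that is, the operator associated with
the closure of `q`. -/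
def IsOperatorOf (q : HermForm H) (A : H →ₗ.[ℂ] H) : Prop :=
  ∃ q' : HermForm H, q'.IsClosureOf q ∧ q'.IsAssociated A

end HermForm

/-! ## The spectrum of an unbounded operator -/

section Spectrum

variable {H : Type*} [NormedAddCommGroup H] [InnerProductSpace ℂ H]

/-- `z` is in the resolvent set of `A`: the map `A - z` from the domain of `A` to `H` has an
everywhere defined bounded two-sided inverse. -/
def InResolventSet (A : H →ₗ.[ℂ] H) (z : ℂ) : Prop :=
  ∃ R : H →L[ℂ] H, (∀ f : H, ∃ h : R f ∈ A.domain, A ⟨R f, h⟩ - z • R f = f) ∧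
    ∀ u : A.domain, R (A u - z • (u : H)) = u

/-- The spectrum of `A`: the complement of the resolvent set. -/
def opSpectrum (A : H →ₗ.[ℂ] H) : Set ℂ := {z | ¬ InResolventSet A z}

/-- The eigenspace of `A` for `z`. -/
def opEigenspace (A : H →ₗ.[ℂ] H) (z : ℂ) : Submodule ℂ A.domain :=
  LinearMap.ker (A.toFun - z • A.domain.subtype)

/-- The spectrum of `A` is discrete: it consists of isolated (in the spectrum) eigenvalues of finite
multiplicity. -/
def HasDiscreteSpectrum (A : H →ₗ.[ℂ] H) : Prop :=
  ∀ z ∈ opSpectrum A,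
    (∃ ε > 0, ∀ w ∈ opSpectrum A, w ≠ z → ε ≤ dist w z) ∧
    opEigenspace A z ≠ ⊥ ∧ FiniteDimensional ℂ (opEigenspace A z)

end Spectrum

/-! ## Jacobi operators -/

namespace Jacobi

/-- The Hilbert space `ℓ²(ℤ₊)` of square summable complex sequences `u₀, u₁, …`. -/
abbrev L2 : Type := lp (fun _ : ℕ => ℂ) 2

/-- The sequence `n ↦ f (n - 1)`, with the convention `f (-1) = 0`. -/
def prev {R : Type*} [Zero R] (f : ℕ → R) : ℕ → R
  | 0 => 0
  | n + 1 => f n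

/-- The set `𝒟` of vectors with only finitely many nonzero components. -/
def finSupp : Submodule ℂ L2 where
  carrier := {u | (Function.support (u : ℕ → ℂ)).Finite}
  zero_mem' := by
    rw [Set.mem_ofPred_eq, lp.coeFn_zero, Function.support_zero]; exact Set.finite_empty
  add_mem' {u v} hu hv := (hu.union hv).subset (by
    rw [lp.coeFn_add]; exact Function.support_add _ _)
  smul_mem' c u hu := hu.subset (by
    rw [lp.coeFn_smul]; exact Function.support_const_smul_subset _ _)

/-- The action of the Jacobi matrix with diagonal entries `b n` and off-diagonal entries `a n`:
`(𝒥 u)ₙ = aₙ₋₁ uₙ₋₁ + bₙ uₙ + aₙ uₙ₊₁`. The convention for the index `-1` gives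
`(𝒥 u)₀ = b₀ u₀ + a₀ u₁`. -/
def matrixAction (a b : ℕ → ℝ) (u : ℕ → ℂ) (n : ℕ) : ℂ :=
  ((prev a n : ℝ) : ℂ) * prev u n + (b n : ℂ) * u n + (a n : ℂ) * u (n + 1)

theorem support_matrixAction_finite (a b : ℕ → ℝ) {u : ℕ → ℂ}
    (hu : (Function.support u).Finite) : (Function.support (matrixAction a b u)).Finite := by
  refine ((hu.image Nat.succ).union (hu.union (hu.image Nat.pred))).subset ?_
  intro n hn
  by_contra h
  simp only [Set.mem_union, Set.mem_image, Function.mem_support, not_or, not_exists, not_and,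
    not_not] at h
  obtain ⟨h1, h2, h3⟩ := h
  apply hn
  have e1 : prev u n = 0 := by
    cases n with
    | zero => rfl
    | succ k =>
      by_contra hk
      exact h1 k hk rfl
  have e3 : u (n + 1) = 0 := by
    by_contra hk
    exact h3 (n + 1) hk rfl
  simp [matrixAction, e1, h2, e3]

/-- The minimal Jacobi operator `J₀ u = 𝒥 u` with domain `𝒟`. -/
def minimalOperator (a b : ℕ → ℝ) : L2 →ₗ.[ℂ] L2 where
  domain := finSupp
  toFun :=
    { toFun := fun u => ⟨matrixAction a b (u : L2),
        (memℓp_zero (support_matrixAction_finite a b u.2)).of_exponent_ge zero_le⟩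
      map_add' := fun u v => by
        ext n
        change matrixAction a b ((u : L2) + (v : L2) : L2) n =
          matrixAction a b (u : L2) n + matrixAction a b (v : L2) n
        rw [lp.coeFn_add]
        cases n <;> simp [matrixAction, prev] <;> ring
      map_smul' := fun c u => by
        ext n
        change matrixAction a b (c • (u : L2) : L2) n = c * matrixAction a b (u : L2) n
        rw [lp.coeFn_smul]
        cases n <;> simp [matrixAction, prev] <;> ring }

theorem minimalOperator_apply (a b : ℕ → ℝ) (u : finSupp) (n : ℕ) :
    (minimalOperator a b u : ℕ → ℂ) n = matrixAction a b (u : L2) n := rfl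

theorem summable_of_mem_finSupp {u : L2} (hu : u ∈ finSupp) (c : ℕ → ℂ) :
    Summable fun n => c n * conj (u n) := by
  refine summable_of_hasFiniteSupport (Set.Finite.subset hu ?_)
  intro n hn h0
  exact hn (by simp [h0])

/-- The scalar product `(J₀ u, v)` as an explicit sum. -/
theorem inner_minimalOperator (a b : ℕ → ℝ) (u v : finSupp) :
    inner ℂ (v : L2) (minimalOperator a b u) =
      ∑' n, (b n : ℂ) * (u : L2) n * conj ((v : L2) n) +
      ∑' n, (((prev a n : ℝ) : ℂ) * prev (u : L2) n + (a n : ℂ) * (u : L2) (n + 1)) *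
        conj ((v : L2) n) := by
  rw [lp.inner_eq_tsum, ← Summable.tsum_add (summable_of_mem_finSupp v.2 _)
    (summable_of_mem_finSupp v.2 _)]
  refine tsum_congr fun n => ?_
  rw [minimalOperator_apply]
  simp only [matrixAction, RCLike.inner_apply]
  ring

/-- The minimal Jacobi operator is symmetric. -/
theorem inner_minimalOperator_symm (a b : ℕ → ℝ) (u v : finSupp) :
    inner ℂ (v : L2) (minimalOperator a b u) = inner ℂ (minimalOperator a b v : L2) (u : L2) := by
  have key : ∀ u v : finSupp, inner ℂ (v : L2) (minimalOperator a b u) =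
      ∑' n, (b n : ℂ) * (u : L2) n * conj ((v : L2) n) +
      (∑' n, (a n : ℂ) * (u : L2) n * conj ((v : L2) (n + 1)) +
       ∑' n, (a n : ℂ) * (u : L2) (n + 1) * conj ((v : L2) n)) := by
    intro u v
    rw [inner_minimalOperator]
    congr 1
    have e : ∀ n, (((prev a n : ℝ) : ℂ) * prev (u : L2) n + (a n : ℂ) * (u : L2) (n + 1)) *
        conj ((v : L2) n) = ((prev a n : ℝ) : ℂ) * prev (u : L2) n * conj ((v : L2) n) +
        (a n : ℂ) * (u : L2) (n + 1) * conj ((v : L2) n) := fun n => by ring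
    rw [tsum_congr e, Summable.tsum_add (summable_of_mem_finSupp v.2 _)
      (summable_of_mem_finSupp v.2 _)]
    congr 1
    rw [(summable_of_mem_finSupp v.2 _).tsum_eq_zero_add]
    simp [prev]
  rw [← inner_conj_symm (minimalOperator a b v : L2) (u : L2), key u v, key v u]
  simp only [map_add, Complex.conj_tsum, map_mul, Complex.conj_conj, Complex.conj_ofReal]
  rw [add_comm (∑' n, (a n : ℂ) * conj ((v : L2) n) * (u : L2) (n + 1))]
  congr 1
  · exact tsum_congr fun n => by ring
  · congr 1 <;> exact tsum_congr fun n => by ring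

/-- The form `J[u,v] = (J₀ u, v)` with domain `𝒟`; `quadraticForm_eq` below writes `J[u,u]` as an
explicit sum. (By the convention for `HermForm`, `J[u,v]` is `(form a b).form v u`.) -/
def form (a b : ℕ → ℝ) : HermForm L2 where
  domain := finSupp
  form := LinearMap.mk₂'ₛₗ (starRingEnd ℂ) (RingHom.id ℂ)
    (fun v u : finSupp => inner ℂ (v : L2) (minimalOperator a b u))
    (fun v v' u => inner_add_left _ _ _)
    (fun c v u => inner_smul_left _ _ _)
    (fun v u u' => by
      rw [← inner_add_right]; congr 1; exact (minimalOperator a b).map_add u u')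
    (fun c v u => by
      rw [RingHom.id_apply, smul_eq_mul, ← inner_smul_right]
      congr 1; exact (minimalOperator a b).map_smul c u)
  symm u v := by
    simp only [LinearMap.mk₂'ₛₗ_apply]
    rw [inner_conj_symm, inner_minimalOperator_symm]

/-- `J[u,u] = ∑ bₙ |uₙ|² + ∑ (aₙ₋₁ uₙ₋₁ + aₙ uₙ₊₁) ūₙ`. -/
theorem quadraticForm_eq (a b : ℕ → ℝ) (u : finSupp) :
    (form a b).form u u = ∑' n, (b n : ℂ) * ((‖(u : L2) n‖ ^ 2 : ℝ) : ℂ) +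
      ∑' n, (((prev a n : ℝ) : ℂ) * prev (u : L2) n + (a n : ℂ) * (u : L2) (n + 1)) *
        conj ((u : L2) n) := by
  change inner ℂ (u : L2) (minimalOperator a b u) = _
  rw [inner_minimalOperator]
  congr 1
  refine tsum_congr fun n => ?_
  rw [mul_assoc, Complex.mul_conj, Complex.normSq_eq_norm_sq]

/-- `sₙ = |bₙ| - |aₙ₋₁| - |aₙ|` (with `a₋₁ = 0`). -/
def gap (a b : ℕ → ℝ) (n : ℕ) : ℝ := |b n| - |prev a n| - |a n|

end Jacobi

end

/-!
The weighted arithmetic–geometric inequality behind the gap condition is an identity. If `ε = ±1` is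
chosen with `ε bₙ → +∞`, then for finitely supported `u`

`ε J[u,u] + c ‖u‖² = ∑ (ε bₙ - |aₙ₋₁| - |aₙ| + c) |uₙ|² + ∑ |aₙ| |uₙ + ε sgn(aₙ) uₙ₊₁|²`

(`Jacobi.inner_pairMap`). The weights `ε bₙ - |aₙ₋₁| - |aₙ|` agree with the gaps `sₙ` for large `n`,
so they tend to infinity and are at least `1` once `c` is large. Semiboundedness follows at once.
The identity also says that the shifted form is the inner product of `ℓ² ⊕ ℓ²` pulled back along an
explicit map. Let `V` be the closure of the range of this map. Dividing the first component by the
square roots of the weights gives a bounded map `j : V → ℓ²` which undoes it on finitely supported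
sequences. This `j` is compact, because the weights tend to infinity, and injective, because on `V`
the second component is a function of the first one (`Jacobi.snd_eq_of_mem_closure`).

The rest is abstract (`HermForm.Realization`). Injectivity of `j` means that the form is closable,
and its closure lives on the range of `j`. The associated operator is `ε ((j j*)⁻¹ - c)`. Since
`j j*` is a compact injective symmetric operator, `shiftedInverse` is self-adjoint, and the Fredholm
alternative together with the orthogonality of eigenvectors shows that its spectrum is discrete.
Uniqueness of the operator is uniqueness of the closure of a form, which holds because a closed form
is semibounded, so that the Cauchy–Schwarz inequality is available for a shift of it
(`HermForm.IsClosureOf.form_eq`).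
-/

noncomputable section

/-! ### Unbounded operators with compact resolvent -/

section ShiftedInverse

variable {H : Type*} [NormedAddCommGroup H] [InnerProductSpace ℂ H]

/-- The operator `ε (R⁻¹ - c)` for an injective bounded operator `R` and `ε = ±1`, given through its
graph: `A u = w` iff `u = R (ε w + c u)`. -/
def shiftedInverse (R : H →L[ℂ] H) (ε c : ℝ) : H →ₗ.[ℂ] H :=
  (LinearMap.eqLocus (LinearMap.fst ℂ H H)
    ((R : H →ₗ[ℂ] H) ∘ₗ ((ε : ℂ) • LinearMap.snd ℂ H H + (c : ℂ) • LinearMap.fst ℂ H H))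
    ).toLinearPMap

variable {R : H →L[ℂ] H} {ε c : ℝ}

theorem mem_graph_shiftedInverse (hR : Function.Injective R) (hε : ε * ε = 1) (u w : H) :
    (u, w) ∈ (shiftedInverse R ε c).graph ↔ u = R ((ε : ℂ) • w + (c : ℂ) • u) := by
  rw [shiftedInverse, Submodule.toLinearPMap_graph_eq]
  · simp [LinearMap.mem_eqLocus]
  · rintro ⟨x, y⟩ hx (rfl : x = 0)
    have hy : R ((ε : ℂ) • y) = R 0 := by simpa [LinearMap.mem_eqLocus] using hx.symm
    have hε0 : (ε : ℂ) ≠ 0 := by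
      rintro h
      rw [Complex.ofReal_eq_zero] at h
      simp [h] at hε
    exact (smul_eq_zero.mp (hR hy)).resolve_left hε0

theorem mk_mem_graph_shiftedInverse (hR : Function.Injective R) (hε : ε * ε = 1) (h : H) :
    (R h, (ε : ℂ) • (h - (c : ℂ) • R h)) ∈ (shiftedInverse R ε c).graph := by
  rw [mem_graph_shiftedInverse hR hε, smul_smul, ← Complex.ofReal_mul, hε]
  simp

theorem isSelfAdjoint_shiftedInverse [CompleteSpace H] (hR : Function.Injective R)
    (hsymm : ∀ x y, inner ℂ (R x) y = inner ℂ x (R y)) (hε : ε * ε = 1) :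
    IsSelfAdjoint (shiftedInverse R ε c) := by
  have hεC : (ε : ℂ) * ε = 1 := by rw [← Complex.ofReal_mul, hε, Complex.ofReal_one]
  -- The domain contains the range of the injective symmetric operator `R`, which is dense.
  have hdense : Dense ((shiftedInverse R ε c).domain : Set H) := by
    rw [Submodule.dense_iff_topologicalClosure_eq_top, Submodule.topologicalClosure_eq_top_iff,
      Submodule.eq_bot_iff]
    intro y hy
    apply hR
    rw [map_zero, ← inner_self_eq_zero (𝕜 := ℂ), hsymm]
    have := LinearPMap.mem_domain_of_mem_graph (mk_mem_graph_shiftedInverse (c := c) hR hε (R y))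
    rw [← inner_conj_symm]
    simp [Submodule.inner_right_of_mem_orthogonal this hy]
  rw [LinearPMap.isSelfAdjoint_def]
  apply LinearPMap.eq_of_eq_graph
  rw [LinearPMap.adjoint_graph_eq_graph_adjoint hdense]
  ext ⟨u, w⟩
  rw [Submodule.mem_adjoint_iff, mem_graph_shiftedInverse hR hε]
  -- On the graph vector with first component `R h`, the defining relation of the adjoint at
  -- `(u, w)` is orthogonality of `h` to `ε u - R (w + ε c u)`.
  have key : ∀ h : H, inner ℂ ((ε : ℂ) • (h - (c : ℂ) • R h)) u - inner ℂ (R h) w =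
      ε * inner ℂ h (u - R ((ε : ℂ) • w + (c : ℂ) • u)) := by
    intro h
    simp only [inner_smul_left, inner_sub_left, inner_sub_right, map_add, map_smul, inner_add_right,
      inner_smul_right, hsymm, Complex.conj_ofReal]
    linear_combination (inner ℂ h (R w)) * hεC
  constructor
  · intro hg
    have h0 : ∀ h : H, inner ℂ h (u - R ((ε : ℂ) • w + (c : ℂ) • u)) = 0 := by
      intro h
      have := hg _ _ (mk_mem_graph_shiftedInverse (c := c) hR hε h)
      rw [key] at this
      exact (mul_eq_zero.mp this).resolve_left (left_ne_zero_of_mul_eq_one hεC)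
    exact sub_eq_zero.mp (inner_self_eq_zero.mp (h0 _))
  · intro hu x y hxy
    have hx := (mem_graph_shiftedInverse hR hε x y).mp hxy
    set h := (ε : ℂ) • y + (c : ℂ) • x with hh
    have hy : y = (ε : ℂ) • (h - (c : ℂ) • R h) := by
      rw [← hx, hh, add_sub_cancel_right, smul_smul, hεC, one_smul]
    change inner ℂ y u - inner ℂ x w = 0
    clear_value h
    rw [hy, hx, key, sub_eq_zero.mpr hu, inner_zero_right, mul_zero]

/-- The resolvent of `ε (R⁻¹ - c)` at `z` is `ε R (1 - ζ R)⁻¹` with `ζ = c + ε z`. -/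
theorem inResolventSet_shiftedInverse (hR : Function.Injective R) (hε : ε * ε = 1) {z : ℂ}
    (h : IsUnit (1 - ((c : ℂ) + ε * z) • R)) : InResolventSet (shiftedInverse R ε c) z := by
  have hεC : (ε : ℂ) * ε = 1 := by rw [← Complex.ofReal_mul, hε, Complex.ofReal_one]
  obtain ⟨⟨U, S, hUS, hSU⟩, hU⟩ := h
  change U = _ at hU
  subst hU
  have hUS' : ∀ f, S f = f + ((c : ℂ) + ε * z) • R (S f) := fun f => by
    have := congrArg (fun T : H →L[ℂ] H => T f) hUS
    simp only [mul_apply_eq_comp, sub_apply,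
      one_apply_eq_self, smul_apply] at this
    rw [sub_eq_iff_eq_add] at this
    exact this
  have hSU' : ∀ f, S (f - ((c : ℂ) + ε * z) • R f) = f := fun f => by
    have := congrArg (fun T : H →L[ℂ] H => T f) hSU
    simpa using this
  refine ⟨(ε : ℂ) • R ∘L S, fun f => ?_, fun u => ?_⟩
  · have hg : ((ε : ℂ) • R (S f), f + z • (ε : ℂ) • R (S f)) ∈ (shiftedInverse R ε c).graph := by
      rw [mem_graph_shiftedInverse hR hε]
      conv_lhs => rw [← map_smul, hUS' f]
      congr 1
      module
    have hd := LinearPMap.mem_domain_of_mem_graph hg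
    refine ⟨hd, ?_⟩
    have := LinearPMap.mem_graph_iff _ |>.mp hg
    obtain ⟨y, hy1, hy2⟩ := this
    have hy : y = ⟨((ε : ℂ) • R ∘L S) f, hd⟩ := Subtype.ext hy1
    rw [← hy, hy2]
    simp
  · have hu := (mem_graph_shiftedInverse hR hε _ _).mp ((shiftedInverse R ε c).mem_graph u)
    set w := shiftedInverse R ε c u
    have : S ((ε : ℂ) • (w - z • (u : H))) = (ε : ℂ) • w + (c : ℂ) • (u : H) := by
      rw [← hSU' ((ε : ℂ) • w + (c : ℂ) • (u : H)), ← hu]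
      congr 1
      module
    rw [smul_apply, ContinuousLinearMap.comp_apply, ← map_smul, ← map_smul,
      this, ← hu]

theorem hasEigenvalue_of_mem_opSpectrum [CompleteSpace H] (hR : Function.Injective R)
    (hcpt : IsCompactOperator R) (hε : ε * ε = 1) {z : ℂ}
    (hz : z ∈ opSpectrum (shiftedInverse R ε c)) :
    (c : ℂ) + ε * z ≠ 0 ∧
      Module.End.HasEigenvalue (R : Module.End ℂ H) ((c : ℂ) + ε * z)⁻¹ := by
  have h := mt (inResolventSet_shiftedInverse hR hε) hz
  have h0 : (c : ℂ) + ε * z ≠ 0 := fun h0 => by simp [h0] at h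
  refine ⟨h0, (hcpt.hasEigenvalue_or_mem_resolventSet (inv_ne_zero h0)).resolve_right fun hr => ?_⟩
  rw [spectrum.mem_resolventSet_iff] at hr
  apply h
  have : 1 - ((c : ℂ) + ε * z) • R =
      Units.mk0 _ h0 • (algebraMap ℂ (H →L[ℂ] H) ((c : ℂ) + ε * z)⁻¹ - R) := by
    rw [Units.smul_mk0, smul_sub, Algebra.algebraMap_eq_smul_one, smul_smul, mul_inv_cancel₀ h0,
      one_smul]
  rw [this]
  exact hr.smul _

/-- A compact symmetric operator has only finitely many eigenvalues outside a ball around `0`: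
unit eigenvectors for distinct eigenvalues are orthogonal, so their images are uniformly
separated. -/
theorem finite_eigenvalues_of_isCompactOperator [CompleteSpace H] (hcpt : IsCompactOperator R)
    (hsymm : ∀ x y, inner ℂ (R x) y = inner ℂ x (R y)) {r : ℝ} (hr : 0 < r) :
    {μ : ℂ | r ≤ ‖μ‖ ∧ Module.End.HasEigenvalue (R : Module.End ℂ H) μ}.Finite := by
  by_contra hinf
  let f := Set.Infinite.natEmbedding _ hinf
  have hv : ∀ n, ∃ v : H, R v = (f n : ℂ) • v ∧ ‖v‖ = 1 := by
    intro n
    obtain ⟨v, hv⟩ := (f n).2.2.exists_hasEigenvector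
    have hv0 : ‖v‖ ≠ 0 := norm_ne_zero_iff.mpr hv.2
    refine ⟨((‖v‖⁻¹ : ℝ) : ℂ) • v, ?_, ?_⟩
    · have := hv.apply_eq_smul
      simp only [ContinuousLinearMap.coe_coe] at this
      rw [map_smul, this, smul_comm]
    · rw [norm_smul, Complex.norm_real, norm_inv, norm_norm, inv_mul_cancel₀ hv0]
  choose v hRv hv1 using hv
  have hS : (R : H →ₗ[ℂ] H).IsSymmetric := fun x y => hsymm x y
  have horth : ∀ m n, m ≠ n → inner ℂ (v m) (v n) = 0 := by
    intro m n hmn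
    have hne : (f m : ℂ) ≠ f n := fun h => hmn (f.injective (Subtype.ext h))
    exact hS.orthogonalFamily_eigenspaces hne
      ⟨v m, Module.End.mem_eigenspace_iff.mpr (hRv m)⟩
      ⟨v n, Module.End.mem_eigenspace_iff.mpr (hRv n)⟩
  have hsep : ∀ m n, m ≠ n → r ≤ ‖R (v m) - R (v n)‖ := by
    intro m n hmn
    have h0 : inner ℂ (R (v m)) (R (v n)) = 0 := by
      rw [hRv, hRv, inner_smul_left, inner_smul_right, horth m n hmn]; simp
    have h1 := norm_sub_sq (𝕜 := ℂ) (R (v m)) (R (v n))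
    rw [h0, map_zero, mul_zero, sub_zero] at h1
    have h2 : r ≤ ‖R (v m)‖ := by rw [hRv, norm_smul, hv1, mul_one]; exact (f m).2.1
    nlinarith [norm_nonneg (R (v m) - R (v n)), norm_nonneg (R (v n))]
  obtain ⟨K, hK, hK'⟩ := hcpt.image_closedBall_subset_compact (1 : ℝ)
  obtain ⟨y, -, ψ, hψ, hψy⟩ := hK.tendsto_subseq
    (x := fun n => R (v n)) (fun n => hK' ⟨v n, by simp [hv1], rfl⟩)
  obtain ⟨N, hN⟩ := Metric.cauchySeq_iff'.mp hψy.cauchySeq r hr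
  have h1 := hN (N + 1) (Nat.le_succ N)
  rw [dist_eq_norm] at h1
  exact h1.not_ge (hsep _ _ (hψ (Nat.lt_succ_self N)).ne')

theorem hasDiscreteSpectrum_shiftedInverse [CompleteSpace H] (hR : Function.Injective R)
    (hsymm : ∀ x y, inner ℂ (R x) y = inner ℂ x (R y)) (hcpt : IsCompactOperator R)
    (hε : ε * ε = 1) : HasDiscreteSpectrum (shiftedInverse R ε c) := by
  have hεC : (ε : ℂ) * ε = 1 := by rw [← Complex.ofReal_mul, hε, Complex.ofReal_one]
  have hεn : ‖(ε : ℂ)‖ = 1 := by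
    have : ‖(ε : ℂ)‖ * ‖(ε : ℂ)‖ = 1 := by rw [← norm_mul, hεC, norm_one]
    nlinarith [norm_nonneg (ε : ℂ)]
  intro z hz
  obtain ⟨h0, hev⟩ := hasEigenvalue_of_mem_opSpectrum hR hcpt hε hz
  set ζ := (c : ℂ) + ε * z with hζ
  refine ⟨?_, ?_, ?_⟩
  · -- Spectral points at distance less than `1` from `z` correspond to eigenvalues of `R` outside
    -- the ball of radius `(‖ζ‖ + 1)⁻¹`, so there are finitely many of them.
    have hfin : (opSpectrum (shiftedInverse R ε c) ∩ Metric.ball z 1).Finite := by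
      have hr : 0 < (‖ζ‖ + 1)⁻¹ := by positivity
      refine Set.Finite.of_finite_image (f := fun w : ℂ => ((c : ℂ) + ε * w)⁻¹)
        ((finite_eigenvalues_of_isCompactOperator hcpt hsymm hr).subset ?_) ?_
      · rintro _ ⟨w, ⟨hw, hwz⟩, rfl⟩
        obtain ⟨hw0, hwev⟩ := hasEigenvalue_of_mem_opSpectrum hR hcpt hε hw
        refine ⟨?_, hwev⟩
        rw [norm_inv]
        refine inv_anti₀ (norm_pos_iff.mpr hw0) ?_
        have e : (c : ℂ) + ε * w = ζ + ε * (w - z) := by rw [hζ]; ring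
        rw [Metric.mem_ball, dist_eq_norm] at hwz
        calc ‖(c : ℂ) + ε * w‖ ≤ ‖ζ‖ + ‖(ε : ℂ) * (w - z)‖ := by rw [e]; exact norm_add_le _ _
          _ ≤ ‖ζ‖ + 1 := by rw [norm_mul, hεn, one_mul]; linarith
      · intro w _ w' _ hww
        have := add_left_cancel (inv_injective hww)
        exact mul_left_cancel₀ (left_ne_zero_of_mul_eq_one hεC) this
    obtain ⟨δ, hδ, hδ'⟩ : ∃ δ > 0,
        ∀ w ∈ (opSpectrum (shiftedInverse R ε c) ∩ Metric.ball z 1) \ {z}, δ ≤ dist w z := by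
      have hcl := (hfin.subset (Set.sdiff_subset (t := {z}))).isClosed
      obtain ⟨δ, hδ, hball⟩ := Metric.isOpen_iff.mp hcl.isOpen_compl z (by simp)
      exact ⟨δ, hδ, fun w hw => not_lt.mp fun h => hball h hw⟩
    refine ⟨min δ 1, by positivity, fun w hw hne => ?_⟩
    by_cases hwz : dist w z < 1
    · exact (min_le_left _ _).trans (hδ' w ⟨⟨hw, hwz⟩, hne⟩)
    · exact (min_le_right _ _).trans (not_lt.mp hwz)
  · obtain ⟨f, hf⟩ := hev.exists_hasEigenvector
    have hRf : R f = ζ⁻¹ • f := hf.apply_eq_smul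
    have hg : (f, z • f) ∈ (shiftedInverse R ε c).graph := by
      rw [mem_graph_shiftedInverse hR hε, smul_smul, ← add_smul, add_comm, ← hζ, map_smul, hRf,
        smul_smul, mul_inv_cancel₀ h0, one_smul]
    obtain ⟨y, hy1, hy2⟩ := (LinearPMap.mem_graph_iff _).mp hg
    simp only at hy1 hy2
    intro hbot
    have hy : y ∈ opEigenspace (shiftedInverse R ε c) z := by
      rw [opEigenspace, LinearMap.mem_ker, LinearMap.sub_apply, LinearMap.smul_apply,
        Submodule.subtype_apply, hy1, sub_eq_zero]
      exact hy2
    rw [hbot, Submodule.mem_bot] at hy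
    exact hf.2 (by rw [← hy1, hy]; rfl)
  · have := ContinuousLinearMap.finite_dimensional_eigenspace hcpt ζ⁻¹ (inv_ne_zero h0)
    have hmem : ∀ u : opEigenspace (shiftedInverse R ε c) z,
        ((u : (shiftedInverse R ε c).domain) : H) ∈
          Module.End.eigenspace (R : Module.End ℂ H) ζ⁻¹ := by
      rintro ⟨u, hu⟩
      have hAu : shiftedInverse R ε c u = z • (u : H) := sub_eq_zero.mp hu
      have := (mem_graph_shiftedInverse hR hε _ _).mp ((shiftedInverse R ε c).mem_graph u)
      rw [hAu, smul_smul, ← add_smul, add_comm, ← hζ, map_smul] at this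
      rw [Module.End.mem_eigenspace_iff]
      change R (u : H) = ζ⁻¹ • (u : H)
      conv_rhs => rw [this]
      rw [smul_smul, inv_mul_cancel₀ h0, one_smul]
    refine Module.Finite.of_injective
      (((shiftedInverse R ε c).domain.subtype ∘ₗ
        (opEigenspace (shiftedInverse R ε c) z).subtype).codRestrict _ hmem) ?_
    intro u v huv
    have h : ((u : (shiftedInverse R ε c).domain) : H) = (v : (shiftedInverse R ε c).domain) :=
      congrArg (fun x : Module.End.eigenspace (R : Module.End ℂ H) ζ⁻¹ => (x : H)) huv
    exact Subtype.ext (Subtype.ext h)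

end ShiftedInverse

/-! ### Semibounded forms and uniqueness of the closure -/

namespace HermForm

variable {H : Type*} [NormedAddCommGroup H] [InnerProductSpace ℂ H]

theorem form_self_eq_re (q : HermForm H) (u : q.domain) :
    q.form u u = ((q.form u u).re : ℂ) :=
  (Complex.conj_eq_iff_re.mp (q.symm u u)).symm

/-- `δ q + γ (·,·)` is positive semidefinite. Both semibounded cases are covered by `δ = ±1`. -/
def IsShiftNonneg (q : HermForm H) (δ γ : ℝ) : Prop :=
  δ * δ = 1 ∧ ∀ u : q.domain, 0 ≤ δ * (q.form u u).re + γ * ‖(u : H)‖ ^ 2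

theorem IsClosed.exists_isShiftNonneg {q : HermForm H} (hq : q.IsClosed) :
    ∃ δ γ : ℝ, q.IsShiftNonneg δ γ := by
  obtain ⟨m, hm⟩ | ⟨M, hM⟩ := hq.1
  · exact ⟨1, -m, by norm_num, fun u => by linarith [hm u]⟩
  · exact ⟨-1, M, by norm_num, fun u => by linarith [hM u]⟩

/-- The semi-inner product `δ q + γ (·,·)`. -/
abbrev shiftCore (q : HermForm H) {δ γ : ℝ} (h : q.IsShiftNonneg δ γ) :
    PreInnerProductSpace.Core ℂ q.domain where
  inner u v := δ * q.form u v + γ * inner ℂ (u : H) (v : H)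
  conj_inner_symm u v := by
    simp [q.symm]
  re_inner_nonneg u := by
    have := h.2 u
    rw [q.form_self_eq_re, inner_self_eq_norm_sq_to_K]
    simpa [← Complex.ofReal_pow] using this
  add_left u v w := by
    simp only [map_add, LinearMap.add_apply, Submodule.coe_add, inner_add_left]; ring
  smul_left u v r := by
    simp only [map_smulₛₗ, LinearMap.smul_apply, Submodule.coe_smul, inner_smul_left, smul_eq_mul]
    ring

/-- The Cauchy–Schwarz inequality for `δ q + γ (·,·)`. -/
theorem IsShiftNonneg.norm_sq_le {q : HermForm H} {δ γ : ℝ} (h : q.IsShiftNonneg δ γ)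
    (u v : q.domain) :
    ‖δ * q.form u v + γ * inner ℂ (u : H) (v : H)‖ ^ 2 ≤
      (δ * (q.form u u).re + γ * ‖(u : H)‖ ^ 2) * (δ * (q.form v v).re + γ * ‖(v : H)‖ ^ 2) := by
  have hre : ∀ w : q.domain, RCLike.re (δ * q.form w w + γ * inner ℂ (w : H) (w : H) : ℂ) =
      δ * (q.form w w).re + γ * ‖(w : H)‖ ^ 2 := by
    intro w
    rw [inner_self_eq_norm_sq_to_K]
    simp [← Complex.ofReal_pow]
  have hcs : ‖δ * q.form u v + γ * inner ℂ (u : H) (v : H)‖ *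
      ‖δ * q.form v u + γ * inner ℂ (v : H) (u : H)‖ ≤
      RCLike.re (δ * q.form u u + γ * inner ℂ (u : H) (u : H) : ℂ) *
      RCLike.re (δ * q.form v v + γ * inner ℂ (v : H) (v : H) : ℂ) :=
    @InnerProductSpace.Core.inner_mul_inner_self_le ℂ _ _ _ _ (q.shiftCore h) u v
  have hsymm : ‖δ * q.form v u + γ * inner ℂ (v : H) (u : H)‖ =
      ‖δ * q.form u v + γ * inner ℂ (u : H) (v : H)‖ :=
    @InnerProductSpace.Core.norm_inner_symm ℂ _ _ _ _ (q.shiftCore h) v u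
  rwa [hsymm, hre, hre, ← sq] at hcs

theorem IsShiftNonneg.sub_le {q : HermForm H} {δ γ : ℝ} (h : q.IsShiftNonneg δ γ)
    (u v : q.domain) :
    δ * (q.form (u - v) (u - v)).re + γ * ‖((u - v : q.domain) : H)‖ ^ 2 ≤
      2 * (δ * (q.form u u).re + γ * ‖(u : H)‖ ^ 2) +
      2 * (δ * (q.form v v).re + γ * ‖(v : H)‖ ^ 2) := by
  have h1 := h.2 (u + v)
  have h2 := parallelogram_law_with_norm ℂ (u : H) (v : H)
  have h3 : (q.form (u + v) (u + v)).re + (q.form (u - v) (u - v)).re =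
      2 * (q.form u u).re + 2 * (q.form v v).re := by
    simp only [map_add, map_sub, LinearMap.add_apply, LinearMap.sub_apply, Complex.add_re,
      Complex.sub_re]
    ring
  rw [Submodule.coe_add] at h1
  rw [Submodule.coe_sub]
  linear_combination h1 + δ * h3 + γ * h2

theorem tendsto_form_self_zero_iff {ι : Type*} {l : Filter ι} (q : HermForm H)
    (x : ι → q.domain) : Tendsto (fun i => q.form (x i) (x i)) l (𝓝 0) ↔
      Tendsto (fun i => (q.form (x i) (x i)).re) l (𝓝 0) := by
  constructor
  · intro h
    exact (Complex.continuous_re.tendsto 0).comp h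
  · intro h
    have := (Complex.continuous_ofReal.tendsto 0).comp h
    rw [Complex.ofReal_zero] at this
    exact this.congr fun i => (q.form_self_eq_re (x i)).symm

theorem IsShiftNonneg.tendsto_shift {q : HermForm H} {δ γ : ℝ}
    {x : ℕ → q.domain} {u : q.domain} (hx : Tendsto (fun n => (x n : H)) atTop (𝓝 u))
    (hq : Tendsto (fun n => q.form (x n - u) (x n - u)) atTop (𝓝 0)) :
    Tendsto (fun n => δ * (q.form (x n - u) (x n - u)).re + γ * ‖((x n - u : q.domain) : H)‖ ^ 2)
      atTop (𝓝 0) := by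
  have h1 := ((q.tendsto_form_self_zero_iff _).mp hq).const_mul δ
  have h2 := ((tendsto_iff_norm_sub_tendsto_zero.mp hx).pow 2).const_mul γ
  simpa using h1.add h2

/-- Convergence in the form norm implies weak convergence with respect to the form. -/
theorem IsShiftNonneg.tendsto_form {q : HermForm H} {δ γ : ℝ} (h : q.IsShiftNonneg δ γ)
    {x : ℕ → q.domain} {u : q.domain} (hx : Tendsto (fun n => (x n : H)) atTop (𝓝 u))
    (hq : Tendsto (fun n => q.form (x n - u) (x n - u)) atTop (𝓝 0)) (v : q.domain) :
    Tendsto (fun n => q.form v (x n)) atTop (𝓝 (q.form v u)) := by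
  have hδ : (δ : ℂ) * δ = 1 := by rw [← Complex.ofReal_mul, h.1, Complex.ofReal_one]
  have h1 := (IsShiftNonneg.tendsto_shift (δ := δ) (γ := γ) hx hq).const_mul
    (δ * (q.form v v).re + γ * ‖(v : H)‖ ^ 2)
  rw [mul_zero] at h1
  have h2 : Tendsto (fun n => δ * q.form v (x n - u) +
      γ * inner ℂ (v : H) ((x n - u : q.domain) : H)) atTop (𝓝 0) := by
    rw [tendsto_zero_iff_norm_tendsto_zero]
    have h3 := squeeze_zero (fun n => sq_nonneg _) (fun n => h.norm_sq_le v (x n - u)) h1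
    simpa using h3.sqrt
  have h3 : Tendsto (fun n => inner ℂ (v : H) (x n : H)) atTop (𝓝 (inner ℂ (v : H) (u : H))) :=
    tendsto_const_nhds.inner hx
  have h4 := ((h2.const_mul (δ : ℂ)).sub ((h3.sub_const (inner ℂ (v : H) (u : H))).const_mul
    ((δ : ℂ) * γ))).add_const (q.form v u)
  simp only [mul_zero, sub_self, zero_add] at h4
  refine h4.congr fun n => ?_
  rw [Submodule.coe_sub, inner_sub_right, map_sub]
  linear_combination (q.form v (x n) - q.form v u) * hδ

theorem IsShiftNonneg.isFormCauchy {q : HermForm H} {δ γ : ℝ} (h : q.IsShiftNonneg δ γ)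
    {x : ℕ → q.domain} {u : q.domain} (hx : Tendsto (fun n => (x n : H)) atTop (𝓝 u))
    (hq : Tendsto (fun n => q.form (x n - u) (x n - u)) atTop (𝓝 0)) : q.IsFormCauchy x := by
  have h1 := IsShiftNonneg.tendsto_shift (δ := δ) (γ := γ) hx hq
  have hfst : Tendsto (Prod.fst : ℕ × ℕ → ℕ) atTop atTop := by
    rw [← prod_atTop_atTop_eq]; exact tendsto_fst
  have hsnd : Tendsto (Prod.snd : ℕ × ℕ → ℕ) atTop atTop := by
    rw [← prod_atTop_atTop_eq]; exact tendsto_snd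
  have h2 : Tendsto (fun p : ℕ × ℕ => δ * (q.form (x p.1 - x p.2) (x p.1 - x p.2)).re +
      γ * ‖((x p.1 - x p.2 : q.domain) : H)‖ ^ 2) atTop (𝓝 0) := by
    refine squeeze_zero (fun p => h.2 _) (fun p => ?_)
      (g := fun p : ℕ × ℕ => 2 * (δ * (q.form (x p.1 - u) (x p.1 - u)).re +
        γ * ‖((x p.1 - u : q.domain) : H)‖ ^ 2) + 2 * (δ * (q.form (x p.2 - u) (x p.2 - u)).re +
        γ * ‖((x p.2 - u : q.domain) : H)‖ ^ 2)) ?_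
    · have := h.sub_le (x p.1 - u) (x p.2 - u)
      rwa [sub_sub_sub_cancel_right] at this
    · simpa using ((h1.comp hfst).const_mul 2).add ((h1.comp hsnd).const_mul 2)
  have h3 : Tendsto (fun p : ℕ × ℕ => ‖((x p.1 - x p.2 : q.domain) : H)‖) atTop (𝓝 0) := by
    have := ((hx.comp hfst).sub (hx.comp hsnd)).norm
    simpa using this
  rw [IsFormCauchy, tendsto_form_self_zero_iff]
  have h4 := (h2.sub ((h3.pow 2).const_mul γ)).const_mul δ
  simp only [ne_eq, OfNat.ofNat_ne_zero, not_false_eq_true, zero_pow, mul_zero, sub_self] at h4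
  refine h4.congr fun p => ?_
  linear_combination (q.form (x p.1 - x p.2) (x p.1 - x p.2)).re * h.1

/-- Each vector in the domain of one closure is the limit of a sequence from the original domain
which converges in the form norms of both closures. -/
theorem IsClosureOf.exists_common_seq {q q₁ q₂ : HermForm H} (h₁ : q₁.IsClosureOf q)
    (h₂ : q₂.IsClosureOf q) (le₁ : q.domain ≤ q₁.domain) (le₂ : q.domain ≤ q₂.domain)
    (u : q₁.domain) : ∃ (hu : (u : H) ∈ q₂.domain) (x : ℕ → q.domain),
      Tendsto (fun n => (x n : H)) atTop (𝓝 u) ∧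
      Tendsto (fun n => q₁.form (Submodule.inclusion le₁ (x n) - u)
        (Submodule.inclusion le₁ (x n) - u)) atTop (𝓝 0) ∧
      Tendsto (fun n => q₂.form (Submodule.inclusion le₂ (x n) - ⟨u, hu⟩)
        (Submodule.inclusion le₂ (x n) - ⟨u, hu⟩)) atTop (𝓝 0) := by
  obtain ⟨hc₁, ⟨_, ext₁⟩, dense₁⟩ := h₁
  obtain ⟨hc₂, ⟨_, ext₂⟩, -⟩ := h₂
  obtain ⟨y, hyq, hyu, hyform⟩ := dense₁ u
  obtain ⟨δ, γ, hs⟩ := hc₁.exists_isShiftNonneg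
  let x : ℕ → q.domain := fun n => ⟨y n, hyq n⟩
  have hcauchy : q₂.IsFormCauchy fun n => Submodule.inclusion le₂ (x n) := by
    have := hs.isFormCauchy hyu hyform
    refine this.congr fun p => ?_
    rw [← map_sub, ext₂]
    exact ext₁ (x p.1 - x p.2) (x p.1 - x p.2)
  obtain ⟨hu, hlim⟩ := hc₂.2 _ u hyu hcauchy
  exact ⟨hu, x, hyu, hyform, hlim⟩

theorem IsClosureOf.domain_eq {q q₁ q₂ : HermForm H} (h₁ : q₁.IsClosureOf q)
    (h₂ : q₂.IsClosureOf q) : q₁.domain = q₂.domain := by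
  obtain ⟨le₁, -⟩ := h₁.2.1
  obtain ⟨le₂, -⟩ := h₂.2.1
  refine le_antisymm (fun u hu => ?_) (fun u hu => ?_)
  · exact (h₁.exists_common_seq h₂ le₁ le₂ ⟨u, hu⟩).1
  · exact (h₂.exists_common_seq h₁ le₂ le₁ ⟨u, hu⟩).1

theorem IsClosureOf.form_eq {q q₁ q₂ : HermForm H} (h₁ : q₁.IsClosureOf q)
    (h₂ : q₂.IsClosureOf q) {u v : H} (hu₁ : u ∈ q₁.domain) (hv₁ : v ∈ q₁.domain)
    (hu₂ : u ∈ q₂.domain) (hv₂ : v ∈ q₂.domain) :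
    q₁.form ⟨v, hv₁⟩ ⟨u, hu₁⟩ = q₂.form ⟨v, hv₂⟩ ⟨u, hu₂⟩ := by
  obtain ⟨le₁, ext₁⟩ := h₁.2.1
  obtain ⟨le₂, ext₂⟩ := h₂.2.1
  obtain ⟨δ₁, γ₁, hs₁⟩ := h₁.1.exists_isShiftNonneg
  obtain ⟨δ₂, γ₂, hs₂⟩ := h₂.1.exists_isShiftNonneg
  -- Passing to the limit in one argument at a time, starting from vectors of `q.domain`.
  have key : ∀ (v : q.domain) (u : H) (hu₁ : u ∈ q₁.domain) (hu₂ : u ∈ q₂.domain),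
      q₁.form (Submodule.inclusion le₁ v) ⟨u, hu₁⟩ =
        q₂.form (Submodule.inclusion le₂ v) ⟨u, hu₂⟩ := by
    intro v u hu₁ hu₂
    obtain ⟨_, x, hx, hx₁, hx₂⟩ := h₁.exists_common_seq h₂ le₁ le₂ ⟨u, hu₁⟩
    refine tendsto_nhds_unique
      (hs₁.tendsto_form (u := ⟨u, hu₁⟩) hx hx₁ (Submodule.inclusion le₁ v))
      ((hs₂.tendsto_form (u := ⟨u, hu₂⟩) hx hx₂ (Submodule.inclusion le₂ v)).congr fun n => ?_)
    rw [ext₁, ext₂]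
  obtain ⟨_, x, hx, hx₁, hx₂⟩ := h₁.exists_common_seq h₂ le₁ le₂ ⟨v, hv₁⟩
  rw [← q₁.symm, ← q₂.symm]
  congr 1
  refine tendsto_nhds_unique (hs₁.tendsto_form (u := ⟨v, hv₁⟩) hx hx₁ ⟨u, hu₁⟩)
    ((hs₂.tendsto_form (u := ⟨v, hv₂⟩) hx hx₂ ⟨u, hu₂⟩).congr fun n => ?_)
  rw [← q₁.symm, ← q₂.symm, key]

theorem IsOperatorOf.unique {q : HermForm H} {A B : H →ₗ.[ℂ] H} (hA : q.IsOperatorOf A)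
    (hB : q.IsOperatorOf B) : A = B := by
  obtain ⟨q₁, h₁, hA⟩ := hA
  obtain ⟨q₂, h₂, hB⟩ := hB
  have hd := h₁.domain_eq h₂
  apply LinearPMap.eq_of_eq_graph
  ext ⟨u, w⟩
  rw [hA, hB]
  constructor
  · rintro ⟨hu, h⟩
    refine ⟨hd.le hu, fun v => ?_⟩
    rw [← h ⟨v, hd.ge v.2⟩]
    exact (h₁.form_eq h₂ _ _ _ _).symm
  · rintro ⟨hu, h⟩
    refine ⟨hd.ge hu, fun v => ?_⟩
    rw [← h ⟨v, hd.le v.2⟩]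
    exact h₁.form_eq h₂ _ _ _ _

/-! ### Forms realized by a Hilbert space embedded in `H` -/

/-- A realization of the shifted form `ε q + c (·,·)`, `ε = ±1`, as the inner product of a Hilbert
space `V` which is continuously embedded in `H` by `incl`: the linear map `lift` identifies the
domain of `q` with a dense subspace of `V`. -/
structure Realization (q : HermForm H) (V : Type*) [NormedAddCommGroup V] [InnerProductSpace ℂ V]
    (ε c : ℝ) where
  incl : V →L[ℂ] H
  lift : q.domain →ₗ[ℂ] V
  sign_sq : ε * ε = 1
  incl_injective : Function.Injective incl
  denseRange_lift : DenseRange lift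
  incl_lift : ∀ u, incl (lift u) = u
  inner_lift : ∀ u v, inner ℂ (lift u) (lift v) = ε * q.form u v + c * inner ℂ (u : H) (v : H)

namespace Realization

variable {q : HermForm H} {V : Type*} [NormedAddCommGroup V] [InnerProductSpace ℂ V] {ε c : ℝ}

theorem sign_sq_complex (r : q.Realization V ε c) : (ε : ℂ) * ε = 1 := by
  rw [← Complex.ofReal_mul, r.sign_sq, Complex.ofReal_one]

variable (r : q.Realization V ε c)

theorem form_self_eq (u : q.domain) :
    q.form u u = ε * ((‖r.lift u‖ ^ 2 - c * ‖(u : H)‖ ^ 2 : ℝ) : ℂ) := by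
  have h := r.inner_lift u u
  rw [inner_self_eq_norm_sq_to_K, inner_self_eq_norm_sq_to_K] at h
  push_cast
  simp only [Complex.coe_algebraMap] at h
  linear_combination (-q.form u u) * r.sign_sq_complex - ε * h

theorem norm_sq_lift (u : q.domain) :
    ‖r.lift u‖ ^ 2 = ε * (q.form u u).re + c * ‖(u : H)‖ ^ 2 := by
  rw [r.form_self_eq u, Complex.re_ofReal_mul, Complex.ofReal_re]
  linear_combination (c * ‖(u : H)‖ ^ 2 - ‖r.lift u‖ ^ 2) * r.sign_sq

theorem shift_nonneg (r : q.Realization V ε c) (u : q.domain) :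
    0 ≤ ε * (q.form u u).re + c * ‖(u : H)‖ ^ 2 := by
  rw [← r.norm_sq_lift u]; positivity

/-- The identification of `V` with its image in `H`. -/
def equivRange : V ≃ₗ[ℂ] LinearMap.range (r.incl : V →ₗ[ℂ] H) :=
  LinearEquiv.ofInjective (r.incl : V →ₗ[ℂ] H) r.incl_injective

theorem coe_equivRange (y : V) : (r.equivRange y : H) = r.incl y := rfl

theorem incl_equivRange_symm (u : LinearMap.range (r.incl : V →ₗ[ℂ] H)) :
    r.incl (r.equivRange.symm u) = u := by
  rw [← coe_equivRange, LinearEquiv.apply_symm_apply]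

/-- The form on the image of `V` in `H` given by `ε ((x, y)_V - c (x, y)_H)`. -/
def closureForm : HermForm H where
  domain := LinearMap.range (r.incl : V →ₗ[ℂ] H)
  form := LinearMap.mk₂'ₛₗ (starRingEnd ℂ) (RingHom.id ℂ)
    (fun v u => ε * (inner ℂ (r.equivRange.symm v) (r.equivRange.symm u) -
      c * inner ℂ (v : H) (u : H)))
    (fun v v' u => by
      simp only [map_add, Submodule.coe_add, inner_add_left]; ring)
    (fun a v u => by
      simp only [map_smul, Submodule.coe_smul, inner_smul_left, smul_eq_mul]; ring)
    (fun v u u' => by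
      simp only [map_add, Submodule.coe_add, inner_add_right]; ring)
    (fun a v u => by
      simp only [map_smul, Submodule.coe_smul, inner_smul_right, smul_eq_mul, RingHom.id_apply]
      ring)
  symm u v := by simp

theorem closureForm_form (v u : r.closureForm.domain) :
    r.closureForm.form v u = ε * (inner ℂ (r.equivRange.symm v) (r.equivRange.symm u) -
      c * inner ℂ (v : H) (u : H)) := rfl

/-- `V` realizes the form on its image as well. -/
def closureRealization : r.closureForm.Realization V ε c where
  incl := r.incl
  lift := r.equivRange.symm.toLinearMap
  sign_sq := r.sign_sq
  incl_injective := r.incl_injective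
  denseRange_lift := r.equivRange.symm.surjective.denseRange
  incl_lift u := r.incl_equivRange_symm u
  inner_lift u v := by
    change inner ℂ (r.equivRange.symm u) (r.equivRange.symm v) = _
    rw [closureForm_form]
    linear_combination (-inner ℂ (r.equivRange.symm u) (r.equivRange.symm v) +
      c * inner ℂ (u : H) (v : H)) * r.sign_sq_complex

theorem surjective_lift_closureRealization :
    Function.Surjective r.closureRealization.lift :=
  r.equivRange.symm.surjective

theorem eq_one_or_eq_neg_one (r : q.Realization V ε c) : ε = 1 ∨ ε = -1 :=
  mul_self_eq_one_iff.mp r.sign_sq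

theorem isBoundedBelow_or_isBoundedAbove (r : q.Realization V ε c) :
    q.IsBoundedBelow ∨ q.IsBoundedAbove := by
  rcases r.eq_one_or_eq_neg_one with rfl | rfl
  · exact .inl ⟨-c, fun u => by linarith [r.shift_nonneg u]⟩
  · exact .inr ⟨c, fun u => by linarith [r.shift_nonneg u]⟩

/-- Convergence in `V` is convergence in the form norm. -/
theorem tendsto_form_sub {x : ℕ → q.domain} {u : q.domain}
    (h : Tendsto (fun n => r.lift (x n)) atTop (𝓝 (r.lift u))) :
    Tendsto (fun n => (x n : H)) atTop (𝓝 u) ∧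
      Tendsto (fun n => q.form (x n - u) (x n - u)) atTop (𝓝 0) := by
  have hx : Tendsto (fun n => (x n : H)) atTop (𝓝 u) := by
    have := (r.incl.continuous.tendsto _).comp h
    rw [r.incl_lift] at this
    exact this.congr fun n => r.incl_lift _
  refine ⟨hx, ?_⟩
  rw [tendsto_form_self_zero_iff]
  have h1 := tendsto_iff_norm_sub_tendsto_zero.mp h
  have h2 := tendsto_iff_norm_sub_tendsto_zero.mp hx
  have h3 := ((h1.pow 2).sub ((h2.pow 2).const_mul c)).const_mul ε
  simp only [ne_eq, OfNat.ofNat_ne_zero, not_false_eq_true, zero_pow, mul_zero, sub_self] at h3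
  refine h3.congr fun n => ?_
  rw [r.form_self_eq, Complex.re_ofReal_mul, Complex.ofReal_re, map_sub, Submodule.coe_sub]

variable [CompleteSpace V]

/-- A form Cauchy sequence which converges in `H` converges in `V` to a preimage of the limit. -/
theorem exists_tendsto_lift {x : ℕ → q.domain} {u : H}
    (hx : Tendsto (fun n => (x n : H)) atTop (𝓝 u)) (hc : q.IsFormCauchy x) :
    ∃ y : V, r.incl y = u ∧ Tendsto (fun n => r.lift (x n)) atTop (𝓝 y) := by
  have hfst : Tendsto (Prod.fst : ℕ × ℕ → ℕ) atTop atTop := by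
    rw [← prod_atTop_atTop_eq]; exact tendsto_fst
  have hsnd : Tendsto (Prod.snd : ℕ × ℕ → ℕ) atTop atTop := by
    rw [← prod_atTop_atTop_eq]; exact tendsto_snd
  have h1 : Tendsto (fun p : ℕ × ℕ => ‖((x p.1 - x p.2 : q.domain) : H)‖) atTop (𝓝 0) := by
    simpa using ((hx.comp hfst).sub (hx.comp hsnd)).norm
  have h2 : Tendsto (fun p : ℕ × ℕ => ‖r.lift (x p.1) - r.lift (x p.2)‖) atTop (𝓝 0) := by
    have h3 := (((q.tendsto_form_self_zero_iff _).mp hc).const_mul ε).add ((h1.pow 2).const_mul c)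
    have h4 := h3.sqrt
    simp only [ne_eq, OfNat.ofNat_ne_zero, not_false_eq_true, zero_pow, mul_zero, add_zero,
      Real.sqrt_zero] at h4
    refine h4.congr fun p => ?_
    rw [← r.norm_sq_lift, map_sub, Real.sqrt_sq (norm_nonneg _)]
  have hcauchy : CauchySeq fun n => r.lift (x n) := by
    rw [cauchySeq_iff_tendsto_dist_atTop_0]
    simpa only [dist_eq_norm] using h2
  obtain ⟨y, hy⟩ := cauchySeq_tendsto_of_complete hcauchy
  refine ⟨y, tendsto_nhds_unique ((r.incl.continuous.tendsto y).comp hy) ?_, hy⟩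
  exact hx.congr fun n => (r.incl_lift _).symm

theorem isClosable (r : q.Realization V ε c) : q.IsClosable := by
  intro x hx hc
  obtain ⟨y, hy0, hy⟩ := r.exists_tendsto_lift hx hc
  obtain rfl : y = 0 := r.incl_injective (by rw [hy0, map_zero])
  rw [tendsto_form_self_zero_iff]
  have h := (((hy.norm.pow 2).sub ((hx.norm.pow 2).const_mul c))).const_mul ε
  simp only [norm_zero, ne_eq, OfNat.ofNat_ne_zero, not_false_eq_true, zero_pow, mul_zero,
    sub_self] at h
  refine h.congr fun n => ?_
  rw [r.form_self_eq, Complex.re_ofReal_mul, Complex.ofReal_re]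

theorem isClosed_of_surjective_lift (hr : Function.Surjective r.lift) : q.IsClosed := by
  refine ⟨r.isBoundedBelow_or_isBoundedAbove, fun x u hx hc => ?_⟩
  obtain ⟨y, rfl, hy⟩ := r.exists_tendsto_lift hx hc
  obtain ⟨u, rfl⟩ := hr y
  have h := (r.tendsto_form_sub hy).2
  have hmem : r.incl (r.lift u) ∈ q.domain := by rw [r.incl_lift]; exact u.2
  have hu : u = ⟨r.incl (r.lift u), hmem⟩ := Subtype.ext (r.incl_lift u).symm
  refine ⟨hmem, ?_⟩
  rwa [← hu]

theorem isClosureOf_closureForm : r.closureForm.IsClosureOf q := by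
  have le : q.domain ≤ r.closureForm.domain := fun u hu => ⟨r.lift ⟨u, hu⟩, r.incl_lift ⟨u, hu⟩⟩
  have hlift : ∀ u : q.domain,
      r.closureRealization.lift (Submodule.inclusion le u) = r.lift u := fun u =>
    r.incl_injective ((r.closureRealization.incl_lift _).trans (r.incl_lift u).symm)
  refine ⟨r.closureRealization.isClosed_of_surjective_lift r.surjective_lift_closureRealization,
    ⟨le, fun u v => ?_⟩, fun u => ?_⟩
  · have h := r.closureRealization.inner_lift (Submodule.inclusion le u) (Submodule.inclusion le v)
    rw [hlift, hlift, r.inner_lift, Submodule.coe_inclusion, Submodule.coe_inclusion,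
      add_left_inj] at h
    exact (mul_left_cancel₀ (left_ne_zero_of_mul_eq_one r.sign_sq_complex) h).symm
  · obtain ⟨y, hyr, hy⟩ :=
      mem_closure_iff_seq_limit.mp (r.denseRange_lift (r.closureRealization.lift u))
    choose x hx using hyr
    refine ⟨fun n => Submodule.inclusion le (x n), fun n => (x n).2,
      r.closureRealization.tendsto_form_sub (hy.congr fun n => ?_)⟩
    rw [← hx, ← hlift]

variable [CompleteSpace H]

theorem injective_incl_comp_adjoint (hd : Dense (q.domain : Set H)) :
    Function.Injective (r.incl ∘L r.incl.adjoint) := by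
  rw [injective_iff_map_eq_zero]
  intro h hh
  have h0 : r.incl.adjoint h = 0 := r.incl_injective (by rw [map_zero]; exact hh)
  refine hd.eq_zero_of_inner_left ℂ fun v hv => ?_
  have hv' : v = r.incl (r.lift ⟨v, hv⟩) := (r.incl_lift ⟨v, hv⟩).symm
  rw [hv', ← ContinuousLinearMap.adjoint_inner_left, h0, inner_zero_left]

/-- The operator associated with a closed form is `ε ((j j*)⁻¹ - c)`, where `j : V → H` is the
embedding: `q[u, v] = (w, v)` for all `v` in the form domain means `u = j j* (ε w + c u)`. -/
theorem isAssociated_shiftedInverse (hr : Function.Surjective r.lift)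
    (hinj : Function.Injective (r.incl ∘L r.incl.adjoint)) :
    q.IsAssociated (shiftedInverse (r.incl ∘L r.incl.adjoint) ε c) := by
  intro u w
  rw [mem_graph_shiftedInverse hinj r.sign_sq]
  have key : ∀ (v : q.domain) (h : H), inner ℂ (r.lift v) (r.incl.adjoint h) = inner ℂ (v : H) h :=
    fun v h => by rw [ContinuousLinearMap.adjoint_inner_right, r.incl_lift]
  constructor
  · intro hu
    obtain ⟨u', hu'⟩ := hr (r.incl.adjoint ((ε : ℂ) • w + (c : ℂ) • u))
    obtain rfl : (u' : H) = u := by rw [← r.incl_lift u', hu']; exact hu.symm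
    refine ⟨u'.2, fun v => ?_⟩
    have h := r.inner_lift v u'
    rw [hu', key, inner_add_right, inner_smul_right, inner_smul_right, add_left_inj] at h
    exact (mul_left_cancel₀ (left_ne_zero_of_mul_eq_one r.sign_sq_complex) h).symm
  · rintro ⟨hu, h⟩
    have hlift : r.incl.adjoint ((ε : ℂ) • w + (c : ℂ) • u) = r.lift ⟨u, hu⟩ := by
      refine ext_inner_left ℂ fun y => ?_
      obtain ⟨v, rfl⟩ := hr y
      rw [key, r.inner_lift, h, inner_add_right, inner_smul_right, inner_smul_right]
    rw [ContinuousLinearMap.comp_apply, hlift, r.incl_lift]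

/-- A densely defined form realized by a compactly embedded Hilbert space defines a unique
operator, which is self-adjoint and has discrete spectrum. -/
theorem exists_isOperatorOf (hd : Dense (q.domain : Set H)) (hcpt : IsCompactOperator r.incl) :
    ∃ A : H →ₗ.[ℂ] H, q.IsOperatorOf A ∧ (∀ B : H →ₗ.[ℂ] H, q.IsOperatorOf B → B = A) ∧
      IsSelfAdjoint A ∧ HasDiscreteSpectrum A := by
  have hinj := r.injective_incl_comp_adjoint hd
  have hop : q.IsOperatorOf (shiftedInverse (r.incl ∘L r.incl.adjoint) ε c) :=
    ⟨_, r.isClosureOf_closureForm, r.closureRealization.isAssociated_shiftedInverse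
      r.surjective_lift_closureRealization hinj⟩
  have hsymm : ∀ x y, inner ℂ ((r.incl ∘L r.incl.adjoint) x) y =
      inner ℂ x ((r.incl ∘L r.incl.adjoint) y) := fun x y => by
    rw [ContinuousLinearMap.comp_apply, ContinuousLinearMap.comp_apply,
      ← ContinuousLinearMap.adjoint_inner_right, ContinuousLinearMap.adjoint_inner_left]
  exact ⟨_, hop, fun B hB => hB.unique hop, isSelfAdjoint_shiftedInverse hinj hsymm r.sign_sq,
    hasDiscreteSpectrum_shiftedInverse hinj hsymm (hcpt.comp_clm _) r.sign_sq⟩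

end Realization

end HermForm

namespace Jacobi

/-! ### Diagonal operators in `ℓ²(ℤ₊)` -/

/-- The diagonal operator `(u n) ↦ (d n * u n)` for a sequence with `|d n| ≤ K`. -/
def diagonal (d : ℕ → ℝ) {K : ℝ} (hK : 0 ≤ K) (hd : ∀ n, |d n| ≤ K) : L2 →L[ℂ] L2 :=
  lp.mapCLM 2 (fun n => (d n : ℂ) • ContinuousLinearMap.id ℂ ℂ) hK (fun n => by
    rw [norm_smul, Complex.norm_real, ContinuousLinearMap.norm_id, mul_one]; exact hd n)

theorem diagonal_apply (d : ℕ → ℝ) {K : ℝ} (hK : 0 ≤ K) (hd : ∀ n, |d n| ≤ K) (u : L2) (n : ℕ) :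
    diagonal d hK hd u n = d n * u n := by
  simp [diagonal]

theorem norm_diagonal_le (d : ℕ → ℝ) {K : ℝ} (hK : 0 ≤ K) (hd : ∀ n, |d n| ≤ K) :
    ‖diagonal d hK hd‖ ≤ K :=
  lp.norm_mapCLM_le _ _ _ _

/-- A diagonal operator whose entries tend to zero is a norm limit of operators of finite rank. -/
theorem isCompactOperator_diagonal {d : ℕ → ℝ} (h0 : Tendsto d atTop (𝓝 0)) {K : ℝ} (hK : 0 ≤ K)
    (hd : ∀ n, |d n| ≤ K) : IsCompactOperator (diagonal d hK hd) := by
  let P : ℕ → L2 →L[ℂ] L2 := fun n => (d n : ℂ) •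
    (lp.singleContinuousLinearMap ℂ (fun _ : ℕ => ℂ) 2 n ∘L lp.evalCLM ℂ (fun _ : ℕ => ℂ) 2 n)
  have hP : ∀ n (u : L2) m, P n u m = if m = n then d n * u n else 0 := by
    intro n u m
    change (d n : ℂ) * (lp.single 2 n (u n) : L2) m = _
    rw [lp.single_apply]
    by_cases hmn : m = n
    · subst hmn; simp
    · simp [hmn]
  have hcpt : ∀ N, IsCompactOperator (∑ n ∈ Finset.range N, P n : L2 →L[ℂ] L2) := by
    intro N
    have : (∑ n ∈ Finset.range N, P n) ∈ compactOperator (RingHom.id ℂ) L2 L2 := by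
      refine Submodule.sum_mem _ fun n _ => Submodule.smul_mem _ _ ?_
      exact (isCompactOperator_of_locallyCompactSpace_rng
        (lp.singleContinuousLinearMap ℂ (fun _ : ℕ => ℂ) 2 n)).comp_clm _
    exact this
  refine isCompactOperator_of_tendsto (l := atTop) (F := fun N => ∑ n ∈ Finset.range N, P n) ?_
    (Eventually.of_forall hcpt)
  rw [Metric.tendsto_atTop]
  intro δ hδ
  obtain ⟨N, hN⟩ := Metric.tendsto_atTop.mp h0 (δ / 2) (by positivity)
  refine ⟨N, fun M hM => ?_⟩
  have htail : ∀ n, |if n < M then 0 else d n| ≤ δ / 2 := by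
    intro n
    split_ifs with h
    · simp; positivity
    · have := hN n (by omega)
      rw [Real.dist_eq, sub_zero] at this
      exact this.le
  have heq : diagonal d hK hd - ∑ n ∈ Finset.range M, P n =
      diagonal (fun n => if n < M then 0 else d n) (by positivity) htail := by
    ext u m
    have hsum : ((∑ n ∈ Finset.range M, P n) u : L2) m = if m < M then d m * u m else 0 := by
      rw [sum_apply, lp.coeFn_sum, Finset.sum_apply]
      simp [hP]
    rw [sub_apply, lp.coeFn_sub, Pi.sub_apply, hsum, diagonal_apply,
      diagonal_apply]
    split_ifs <;> simp
  rw [dist_comm, dist_eq_norm, heq]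
  exact (norm_diagonal_le _ _ _).trans_lt (by linarith)

theorem dense_finSupp : Dense (finSupp : Set L2) := by
  intro u
  refine mem_closure_of_tendsto (lp.hasSum_single (by simp) u) (Eventually.of_forall fun s => ?_)
  refine Submodule.sum_mem _ fun n _ => ?_
  refine (Set.finite_singleton n).subset fun m hm => ?_
  by_contra h
  exact hm (lp.single_apply_ne _ _ _ h)

/-! ### The shifted Jacobi form as a sum of squares -/

/-- The map `(u n) ↦ (p n * u n + r n * u (n + 1))` on finitely supported sequences. -/
def bandMap (p r : ℕ → ℝ) : finSupp →ₗ[ℂ] L2 where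
  toFun u := ⟨fun n => p n * (u : L2) n + r n * (u : L2) (n + 1), by
    refine (memℓp_zero ?_).of_exponent_ge zero_le
    refine (u.2.union (u.2.image Nat.pred)).subset fun n hn => ?_
    by_contra h
    rw [Set.mem_union, not_or] at h
    have h1 : (u : L2) n = 0 := not_not.mp h.1
    have h2 : (u : L2) (n + 1) = 0 := by
      by_contra h2
      exact h.2 ⟨n + 1, h2, rfl⟩
    exact hn (by simp [h1, h2])⟩
  map_add' u v := by
    ext n
    change (p n : ℂ) * ((u : L2) + (v : L2) : L2) n + r n * ((u : L2) + (v : L2) : L2) (n + 1) =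
      (p n * (u : L2) n + r n * (u : L2) (n + 1)) + (p n * (v : L2) n + r n * (v : L2) (n + 1))
    simp only [lp.coeFn_add, Pi.add_apply]
    ring
  map_smul' k u := by
    ext n
    change (p n : ℂ) * (k • (u : L2) : L2) n + r n * (k • (u : L2) : L2) (n + 1) =
      k * (p n * (u : L2) n + r n * (u : L2) (n + 1))
    simp only [lp.coeFn_smul, Pi.smul_apply, smul_eq_mul]
    ring

theorem bandMap_apply (p r : ℕ → ℝ) (u : finSupp) (n : ℕ) :
    bandMap p r u n = p n * (u : L2) n + r n * (u : L2) (n + 1) := rfl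

/-- The Hilbert space `ℓ² ⊕ ℓ²` in which the shifted Jacobi form becomes the inner product. -/
abbrev L2Pair : Type := WithLp 2 (L2 × L2)

/-- The map `u ↦ ((p n * u n), (α n * u n + β n * u (n + 1)))` into `ℓ² ⊕ ℓ²`. -/
def pairMap (p α β : ℕ → ℝ) : finSupp →ₗ[ℂ] L2Pair :=
  (WithLp.linearEquiv 2 ℂ (L2 × L2)).symm.toLinearMap ∘ₗ (bandMap p 0).prod (bandMap α β)

/-- Discrete integration by parts: if `α² = β² = |a|`, `α β = ε a` and
`p n ^ 2 = ε * b n - |a (n - 1)| - |a n| + c`, then the shifted form `ε J + c` is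
`∑ (p n)² |u n|² + ∑ |α n u n + β n u (n + 1)|²`. -/
theorem inner_pairMap (a b : ℕ → ℝ) {ε c : ℝ} {p α β : ℕ → ℝ}
    (hp : ∀ n, p n ^ 2 = ε * b n - |prev a n| - |a n| + c) (hα : ∀ n, α n ^ 2 = |a n|)
    (hβ : ∀ n, β n ^ 2 = |a n|) (hαβ : ∀ n, α n * β n = ε * a n) (u v : finSupp) :
    inner ℂ (pairMap p α β u) (pairMap p α β v) =
      ε * (form a b).form u v + c * inner ℂ (u : L2) (v : L2) := by
  have hL : inner ℂ (pairMap p α β u) (pairMap p α β v) =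
      inner ℂ (bandMap p 0 u) (bandMap p 0 v) + inner ℂ (bandMap α β u) (bandMap α β v) := rfl
  have h1 := (lp.hasSum_inner (𝕜 := ℂ) (bandMap p 0 u) (bandMap p 0 v)).add
    (lp.hasSum_inner (𝕜 := ℂ) (bandMap α β u) (bandMap α β v))
  have h2 : HasSum _ ((form a b).form u v) :=
    lp.hasSum_inner (u : L2) (minimalOperator a b v)
  have h3 := (h2.mul_left (ε : ℂ)).add ((lp.hasSum_inner (𝕜 := ℂ) (u : L2) (v : L2)).mul_left (c : ℂ))
  -- The two series differ termwise by the increments of `h`, and `h 0 = 0`.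
  let h : ℕ → ℂ := fun n => ((|prev a n| : ℝ) * (v : L2) n +
    ε * (prev a n : ℝ) * prev (v : L2) n) * conj ((u : L2) n)
  have hh : Summable h := summable_of_mem_finSupp u.2 _
  have h4 : HasSum (fun n => h (n + 1)) (∑' n, h n) := by
    rw [hh.tsum_eq_zero_add]
    have : h 0 = 0 := by simp [h, prev]
    rw [this, zero_add]
    exact ((summable_nat_add_iff 1).mpr hh).hasSum
  have h5 := h3.add (h4.sub hh.hasSum)
  rw [sub_self, add_zero] at h5
  rw [hL]
  refine h1.unique (h5.congr_fun ?_)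
  intro n
  have hp' : (p n : ℂ) ^ 2 = ε * b n - (|prev a n| : ℝ) - (|a n| : ℝ) + c := by
    exact_mod_cast hp n
  have hα' : (α n : ℂ) ^ 2 = (|a n| : ℝ) := by exact_mod_cast hα n
  have hβ' : (β n : ℂ) ^ 2 = (|a n| : ℝ) := by exact_mod_cast hβ n
  have hαβ' : (α n : ℂ) * β n = ε * a n := by exact_mod_cast hαβ n
  have hpa : prev a (n + 1) = a n := rfl
  have hpv : prev (v : L2) (n + 1) = (v : L2) n := rfl
  simp only [h, RCLike.inner_apply, bandMap_apply, minimalOperator_apply, matrixAction, hpa, hpv,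
    map_add, map_mul, Complex.conj_ofReal, Pi.zero_apply, Complex.ofReal_zero, zero_mul, add_zero]
  linear_combination ((v : L2) n * conj ((u : L2) n)) * (hp' + hα') +
    ((v : L2) (n + 1) * conj ((u : L2) n) + (v : L2) n * conj ((u : L2) (n + 1))) * hαβ' +
    ((v : L2) (n + 1) * conj ((u : L2) (n + 1))) * hβ'

/-- On the closure of the range of `pairMap` the second component is determined by the first. -/
theorem snd_eq_of_mem_closure {p α β d : ℕ → ℝ} (hdp : ∀ n, d n * p n = 1) {x : L2Pair}
    (hx : x ∈ (LinearMap.range (pairMap p α β)).topologicalClosure) (n : ℕ) :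
    x.snd n = α n * (d n * x.fst n) + β n * (d (n + 1) * x.fst (n + 1)) := by
  have hev : ∀ n, Continuous fun u : L2 => u n := fun n =>
    (lp.evalCLM ℂ (fun _ : ℕ => ℂ) 2 n).continuous
  have hfst : Continuous fun x : L2Pair => x.fst := by fun_prop
  have hsnd : Continuous fun x : L2Pair => x.snd := by fun_prop
  have hcl : IsClosed {x : L2Pair |
      x.snd n = α n * (d n * x.fst n) + β n * (d (n + 1) * x.fst (n + 1))} := by
    refine isClosed_eq ((hev n).comp hsnd) ?_
    exact (continuous_const.mul (continuous_const.mul ((hev n).comp hfst))).add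
      (continuous_const.mul (continuous_const.mul ((hev (n + 1)).comp hfst)))
  refine closure_minimal ?_ hcl hx
  rintro _ ⟨u, rfl⟩
  have hd : ∀ n, (d n : ℂ) * p n = 1 := fun n => by exact_mod_cast hdp n
  change bandMap α β u n = α n * (d n * bandMap p 0 u n) +
    β n * (d (n + 1) * bandMap p 0 u (n + 1))
  simp only [bandMap_apply, Pi.zero_apply, Complex.ofReal_zero, zero_mul, add_zero]
  linear_combination (-(α n * (u : L2) n)) * hd n - (β n * (u : L2) (n + 1)) * hd (n + 1)

/-- The map `(f, g) ↦ (d n * f n)`. -/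
def pairIncl (d : ℕ → ℝ) {K : ℝ} (hK : 0 ≤ K) (hd : ∀ n, |d n| ≤ K) : L2Pair →L[ℂ] L2 :=
  diagonal d hK hd ∘L ContinuousLinearMap.fst ℂ L2 L2 ∘L
    (WithLp.prodContinuousLinearEquiv 2 ℂ L2 L2 : L2Pair →L[ℂ] L2 × L2)

theorem pairIncl_apply (d : ℕ → ℝ) {K : ℝ} (hK : 0 ≤ K) (hd : ∀ n, |d n| ≤ K) (x : L2Pair)
    (n : ℕ) : pairIncl d hK hd x n = d n * x.fst n :=
  diagonal_apply d hK hd x.fst n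

/-- The shifted Jacobi form is realized by the closure of the range of `pairMap`. -/
def realization (a b : ℕ → ℝ) {ε c : ℝ} {p α β d : ℕ → ℝ} {K : ℝ} (hK : 0 ≤ K)
    (hd : ∀ n, |d n| ≤ K) (hdp : ∀ n, d n * p n = 1) (hε : ε * ε = 1)
    (hp : ∀ n, p n ^ 2 = ε * b n - |prev a n| - |a n| + c) (hα : ∀ n, α n ^ 2 = |a n|)
    (hβ : ∀ n, β n ^ 2 = |a n|) (hαβ : ∀ n, α n * β n = ε * a n) :
    (form a b).Realization (LinearMap.range (pairMap p α β)).topologicalClosure ε c where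
  incl := pairIncl d hK hd ∘L (LinearMap.range (pairMap p α β)).topologicalClosure.subtypeL
  lift := (pairMap p α β).codRestrict _ fun u => subset_closure ⟨u, rfl⟩
  sign_sq := hε
  incl_injective := by
    rw [injective_iff_map_eq_zero]
    rintro ⟨x, hx⟩ h0
    have hfst : ∀ n, d n * x.fst n = 0 := fun n => by
      rw [← pairIncl_apply d hK hd x n]
      exact congrArg (fun u : L2 => u n) h0
    have h1 : x.fst = 0 := by
      ext n
      have hdn : (d n : ℂ) ≠ 0 := by
        exact_mod_cast left_ne_zero_of_mul_eq_one (hdp n)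
      exact (mul_eq_zero.mp (hfst n)).resolve_left hdn
    have h2 : x.snd = 0 := by
      ext n
      rw [snd_eq_of_mem_closure hdp hx, hfst, hfst]
      simp
    exact Subtype.ext (WithLp.ofLp_injective 2 (Prod.ext h1 h2))
  denseRange_lift := by
    rintro ⟨x, hx⟩
    rw [closure_subtype]
    refine closure_mono ?_ hx
    rintro _ ⟨u, rfl⟩
    exact ⟨_, ⟨u, rfl⟩, rfl⟩
  incl_lift u := by
    ext n
    change pairIncl d hK hd (pairMap p α β u) n = (u : L2) n
    rw [pairIncl_apply]
    change (d n : ℂ) * ((p n : ℂ) * (u : L2) n + ((0 : ℝ) : ℂ) * (u : L2) (n + 1)) = (u : L2) n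
    have h : (d n : ℂ) * p n = 1 := by exact_mod_cast hdp n
    rw [Complex.ofReal_zero, zero_mul, add_zero, ← mul_assoc, h, one_mul]
  inner_lift u v := inner_pairMap a b hp hα hβ hαβ u v

/-- If `ε bₙ → +∞` and the gaps tend to infinity, a shifted Jacobi form is realized by a compactly
embedded Hilbert space. -/
theorem exists_realization {a b : ℕ → ℝ} {ε : ℝ} (hε : ε * ε = 1)
    (hb : Tendsto (fun n => ε * b n) atTop atTop) (hs : Tendsto (gap a b) atTop atTop) :
    ∃ (c : ℝ) (V : Submodule ℂ L2Pair) (_ : CompleteSpace V)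
      (r : (form a b).Realization V ε c), IsCompactOperator r.incl := by
  have hσ : Tendsto (fun n => ε * b n - |prev a n| - |a n|) atTop atTop := by
    refine hs.congr' ?_
    filter_upwards [hb.eventually_ge_atTop 0] with n hn
    have h1 : |ε| = 1 := by
      rcases mul_self_eq_one_iff.mp hε with rfl | rfl <;> simp
    have : |b n| = ε * b n := by
      rw [← abs_of_nonneg hn, abs_mul, h1, one_mul]
    rw [gap, this]
  obtain ⟨m, hm⟩ := bddBelow_range_of_tendsto_atTop_atTop hσ
  have hm' : ∀ n, 1 ≤ ε * b n - |prev a n| - |a n| + (1 - m) := fun n => by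
    linarith [hm ⟨n, rfl⟩]
  let p : ℕ → ℝ := fun n => √(ε * b n - |prev a n| - |a n| + (1 - m))
  have hp1 : ∀ n, 1 ≤ p n := fun n => Real.one_le_sqrt.mpr (hm' n)
  let α : ℕ → ℝ := fun n => √|a n|
  let β : ℕ → ℝ := fun n => ε * SignType.sign (a n) * √|a n|
  have hα : ∀ n, α n ^ 2 = |a n| := fun n => Real.sq_sqrt (abs_nonneg _)
  have hd : ∀ n, |(p n)⁻¹| ≤ 1 := fun n => by
    rw [abs_of_nonneg (inv_nonneg.mpr (zero_le_one.trans (hp1 n)))]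
    exact inv_le_one_of_one_le₀ (hp1 n)
  refine ⟨1 - m, _, inferInstance, realization a b (p := p) (α := α) (β := β)
    (d := fun n => (p n)⁻¹) zero_le_one hd ?_ hε ?_ hα ?_ ?_, ?_⟩
  · exact fun n => inv_mul_cancel₀ (zero_lt_one.trans_le (hp1 n)).ne'
  · exact fun n => Real.sq_sqrt (zero_le_one.trans (hm' n))
  · intro n
    rcases lt_trichotomy (a n) 0 with h | h | h
    · simp [β, h, mul_pow, pow_two ε, hε]
    · simp [β, h]
    · simp [β, h, mul_pow, pow_two ε, hε]
  · intro n
    have h1 : √|a n| * √|a n| = |a n| := Real.mul_self_sqrt (abs_nonneg _)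
    have h2 : (SignType.sign (a n) : ℝ) * |a n| = a n := sign_mul_abs (a n)
    simp only [α, β]
    linear_combination (ε * SignType.sign (a n)) * h1 + ε * h2
  · refine IsCompactOperator.comp_clm (IsCompactOperator.comp_clm
      (isCompactOperator_diagonal ?_ zero_le_one hd) _) _
    refine tendsto_inv_atTop_zero.comp (Real.tendsto_sqrt_atTop.comp ?_)
    exact tendsto_atTop_add_const_right _ _ hσ

end Jacobi

end

theorem proposition5p10 (a b : ℕ → ℝ)
    (hb : Tendsto b atTop atTop ∨ Tendsto b atTop atBot)
    (hs : Tendsto (Jacobi.gap a b) atTop atTop) :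
    (Tendsto b atTop atTop → (Jacobi.form a b).IsBoundedBelow) ∧
    (Tendsto b atTop atBot → (Jacobi.form a b).IsBoundedAbove) ∧
    (Jacobi.form a b).IsClosable ∧
    ∃ J : Jacobi.L2 →ₗ.[ℂ] Jacobi.L2,
      (Jacobi.form a b).IsOperatorOf J ∧
      (∀ J' : Jacobi.L2 →ₗ.[ℂ] Jacobi.L2, (Jacobi.form a b).IsOperatorOf J' → J' = J) ∧
      IsSelfAdjoint J ∧ HasDiscreteSpectrum J := by
  have hpos : Tendsto b atTop atTop → Tendsto (fun n => (1 : ℝ) * b n) atTop atTop := fun h => by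
    simpa using h
  have hneg : Tendsto b atTop atBot → Tendsto (fun n => (-1 : ℝ) * b n) atTop atTop := fun h => by
    simpa only [neg_one_mul] using! tendsto_neg_atBot_atTop.comp h
  refine ⟨fun h => ?_, fun h => ?_, ?_⟩
  · obtain ⟨c, V, _, r, -⟩ := Jacobi.exists_realization (by norm_num) (hpos h) hs
    exact ⟨-c, fun u => by linarith [r.shift_nonneg u]⟩
  · obtain ⟨c, V, _, r, -⟩ := Jacobi.exists_realization (by norm_num) (hneg h) hs
    exact ⟨c, fun u => by linarith [r.shift_nonneg u]⟩
  · obtain ⟨ε, hε, hεb⟩ : ∃ ε : ℝ, ε * ε = 1 ∧ Tendsto (fun n => ε * b n) atTop atTop := by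
      rcases hb with h | h
      · exact ⟨1, by norm_num, hpos h⟩
      · exact ⟨-1, by norm_num, hneg h⟩
    obtain ⟨c, V, _, r, hcpt⟩ := Jacobi.exists_realization hε hεb hs
    exact ⟨r.isClosable, r.exists_isOperatorOf Jacobi.dense_finSupp hcpt⟩
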